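/- Let $\Gamma=(V,E)$ and $\Gamma'=(V',E')$ be finite simple graphs, let $G$ be a group, and let $(G_v)_{v\in V}$ and $(G_{v'})_{v'\in V'}$ be families of nontrivial finite subgroups of $G$. Suppose that $G$ is the internal graph product of $(\Gamma, G_v)$ and also of $(\Gamma', G_{v'})$. Here $G$ is the internal graph product of $(\Gamma,G_v)$ if the inclusions $G_v\hookrightarrow G$ induce an isomorphism $F/N\to G$, where $F$ is the free product of the groups $G_v$ ($v\in V$) and $N$ is the normal closure in $F$ of all $g^{-1}h^{-1}gh$ with $g\in G_u$, $h\in G_v$, $\{u,v\}\in E$. A clique is a maximal complete set of vertices. For a set $A$ of vertices of $\Gamma$ (or of $\Gamma'$), let $G(A)$ be the subgroup of $G$ generated by the subgroups $G_a$ with $a\in A$. For a subgroup $F$ of $G$, let $[F]=\{gFg^{-1} : g\in G\}$. Then for each clique $C$ of $\Gamma$ there is a unique clique $C'$ of $\Gamma'$ such that $[G(C)]=[G(C')]$, that is, such that $G(C)$ and $G(C')$ are conjugate in $G$. -/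

import Mathlib

universe u v

/-- The defining relators `g⁻¹ h⁻¹ g h` of the graph product, for `g ∈ G a`, `h ∈ G b` with `a`, `b`
adjacent, as elements of the free product. -/
def graphProductRels {V : Type u} (Γ : SimpleGraph V) (G : V → Type v) [∀ a, Group (G a)] :
    Set (Monoid.CoprodI G) :=
  {r | ∃ (a b : V) (g : G a) (h : G b), Γ.Adj a b ∧
    r = (Monoid.CoprodI.of g)⁻¹ * (Monoid.CoprodI.of h)⁻¹ *
      Monoid.CoprodI.of g * Monoid.CoprodI.of h}

/-- The graph product of the graph of groups `(Γ, G)`: the quotient of the free product of the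
vertex groups by the normal closure of the commutators of elements of adjacent vertex groups. -/
def GraphProduct {V : Type u} (Γ : SimpleGraph V) (G : V → Type v) [∀ a, Group (G a)] :
    Type (max u v) :=
  Monoid.CoprodI G ⧸ Subgroup.normalClosure (graphProductRels Γ G)

instance GraphProduct.instGroup {V : Type u} (Γ : SimpleGraph V) (G : V → Type v)
    [∀ a, Group (G a)] : Group (GraphProduct Γ G) :=
  QuotientGroup.Quotient.group (Subgroup.normalClosure (graphProductRels Γ G))

/-- The canonical homomorphism from a vertex group to the graph product. -/
def GraphProduct.of {V : Type u} (Γ : SimpleGraph V) (G : V → Type v) [∀ a, Group (G a)] (a : V) :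
    G a →* GraphProduct Γ G :=
  (QuotientGroup.mk' (Subgroup.normalClosure (graphProductRels Γ G))).comp Monoid.CoprodI.of

/-- `G` is the internal graph product of the subgroups `H a` over the graph `Γ`: the inclusions
`H a ≤ G` induce an isomorphism from the graph product of `(Γ, H)` onto `G`. -/
def IsInternalGraphProduct {V : Type u} (Γ : SimpleGraph V) {G : Type v} [Group G]
    (H : V → Subgroup G) : Prop :=
  ∃ e : GraphProduct Γ (fun a => H a) ≃* G,
    ∀ (a : V) (x : H a), e (GraphProduct.of Γ (fun a => H a) a x) = (x : G)

/-- `G(A)`: the subgroup generated by the vertex groups `H a` with `a ∈ A`. -/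
def vertexSubgroup {V : Type u} {G : Type v} [Group G] (H : V → Subgroup G) (A : Set V) :
    Subgroup G :=
  Subgroup.closure (⋃ a ∈ A, (H a : Set G))

/-- A clique in the sense of a maximal complete set of vertices (Mathlib's `SimpleGraph.IsClique`
means complete, not necessarily maximal). -/
def IsMaximalClique {V : Type u} (Γ : SimpleGraph V) (C : Set V) : Prop :=
  Maximal Γ.IsClique C

/-- `[F]`: the set of subgroups `g F g⁻¹` of `G` that are conjugate to `F`. -/
def subgroupConjClass {G : Type v} [Group G] (F : Subgroup G) : Set (Subgroup G) :=
  {K | ∃ g : G, K = F.map (MulAut.conj g).toMonoidHom}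

open Function Monoid

/-! If `v` and `w` are distinct and not adjacent, `G(A)` is the amalgam of `G(A \ {v})` and `G(A \
{w})` over `G(A \ {v, w})`. A finite subgroup of an amalgam is conjugate into a factor
(`exists_conj_mem_range_of_finite`): its word lengths are bounded, and conjugating by a common first
letter lowers a bound above 1. Deleting vertices therefore conjugates any finite subgroup into
`G(C)` with `C` complete.

Since `G(C)` is itself finite, it is conjugate into some `G(C')`, which in turn is conjugate into
some `G(D)`. Retracting onto one vertex group shows that a conjugate of `G(C)` lies in `G(D)` only
if `C ⊆ D` (`subset_of_map_conj_le`). Maximality gives `C = D`, and comparing orders turns the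
inclusions into equalities. The same lemma gives uniqueness. -/

namespace Monoid.PushoutI

/-! ### Reduced words and length in amalgamated products -/

section ReducedList

variable {ι : Type*} {G : ι → Type*} {H : Type*} [∀ i, Group (G i)] [Group H] {φ : ∀ i, H →* G i}

variable (φ) in
/-- A list of letters is reduced if consecutive letters come from distinct factors and no letter
lies in the image of the base group. -/
def IsReducedList (l : List (Σ i, G i)) : Prop :=
  l.IsChain (fun x y => x.1 ≠ y.1) ∧ ∀ x ∈ l, x.2 ∉ (φ x.1).range

variable (φ) in
/-- The product in the amalgamated product of a list of letters. -/
def listProd (l : List (Σ i, G i)) : PushoutI φ :=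
  (l.map fun x => of x.1 x.2).prod

@[simp] theorem listProd_nil : listProd φ [] = 1 := rfl

@[simp] theorem listProd_cons (x : Σ i, G i) (l : List (Σ i, G i)) :
    listProd φ (x :: l) = of x.1 x.2 * listProd φ l := by
  simp [listProd]

@[simp] theorem listProd_append (l l' : List (Σ i, G i)) :
    listProd φ (l ++ l') = listProd φ l * listProd φ l' := by
  simp [listProd]

/-- The formal inverse of a list of letters. -/
def listInv (l : List (Σ i, G i)) : List (Σ i, G i) :=
  (l.map fun x => (⟨x.1, x.2⁻¹⟩ : Σ i, G i)).reverse

@[simp] theorem length_listInv (l : List (Σ i, G i)) : (listInv l).length = l.length := by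
  simp [listInv]

theorem listProd_listInv (l : List (Σ i, G i)) :
    listProd φ (listInv l) = (listProd φ l)⁻¹ := by
  induction l with
  | nil => simp [listInv]
  | cons x l ih =>
    have : listInv (x :: l) = listInv l ++ [⟨x.1, x.2⁻¹⟩] := by simp [listInv]
    rw [this, listProd_append, ih]
    simp

theorem IsReducedList.listInv {l : List (Σ i, G i)} (hl : IsReducedList φ l) :
    IsReducedList φ (listInv l) := by
  refine ⟨?_, ?_⟩
  · rw [PushoutI.listInv, List.isChain_reverse, List.isChain_map]
    exact hl.1.imp fun _ _ h => h.symm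
  · intro x hx
    simp only [PushoutI.listInv, List.mem_reverse, List.mem_map] at hx
    obtain ⟨y, hy, rfl⟩ := hx
    simpa using hl.2 y hy

theorem IsReducedList.tail {x : Σ i, G i} {l : List (Σ i, G i)} (hl : IsReducedList φ (x :: l)) :
    IsReducedList φ l :=
  ⟨hl.1.tail, fun y hy => hl.2 y (List.mem_cons_of_mem _ hy)⟩

theorem isChain_fst_ne_of_map_fst_eq {A : ι → Type*} {l l' : List (Σ i, A i)}
    (hl : l.IsChain fun x y => x.1 ≠ y.1) (h : l'.map Sigma.fst = l.map Sigma.fst) :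
    l'.IsChain fun x y => x.1 ≠ y.1 := by
  rw [← List.isChain_map (R := (· ≠ ·)) Sigma.fst] at hl ⊢
  rwa [h]

theorem IsReducedList.of_map_fst_eq {l l' : List (Σ i, G i)} (hl : IsReducedList φ l)
    (h : l'.map Sigma.fst = l.map Sigma.fst) (h' : ∀ x ∈ l', x.2 ∉ (φ x.1).range) :
    IsReducedList φ l' :=
  ⟨isChain_fst_ne_of_map_fst_eq hl.1 h, h'⟩

/-- Letters of the base group can be moved from the right end to the left end. -/
theorem exists_listProd_mul_base {l : List (Σ i, G i)} (hl : IsReducedList φ l) (d : H) :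
    ∃ (c : H) (l' : List (Σ i, G i)), IsReducedList φ l' ∧ l'.map Sigma.fst = l.map Sigma.fst ∧
      listProd φ l * base φ d = base φ c * listProd φ l' := by
  induction l with
  | nil => exact ⟨d, [], hl, rfl, by simp⟩
  | cons x l ih =>
    obtain ⟨c, l', hl', hmap, h⟩ := ih hl.tail
    have hmap' : ((⟨x.1, x.2 * φ x.1 c⟩ : Σ i, G i) :: l').map Sigma.fst
        = (x :: l).map Sigma.fst := by simp [hmap]
    refine ⟨1, ⟨x.1, x.2 * φ x.1 c⟩ :: l', hl.of_map_fst_eq hmap' ?_, hmap', ?_⟩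
    · intro y hy
      rcases List.mem_cons.1 hy with rfl | hy
      · have := hl.2 x List.mem_cons_self
        rwa [Subgroup.mul_mem_cancel_right _ (MonoidHom.mem_range.2 ⟨c, rfl⟩)]
      · exact hl'.2 y hy
    · simp only [listProd_cons, map_one, one_mul, map_mul, of_apply_eq_base, mul_assoc, h]

theorem exists_base_mul_listProd_eq (hφ : ∀ i, Injective (φ i)) (g : PushoutI φ) :
    ∃ (c : H) (l : List (Σ i, G i)), IsReducedList φ l ∧ g = base φ c * listProd φ l := by
  classical
  obtain ⟨d⟩ := NormalWord.transversal_nonempty φ hφ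
  let w := NormalWord.equiv (d := d) g
  have hw : w.prod = g := NormalWord.equiv.symm_apply_apply g
  refine ⟨w.head, w.toList, ⟨w.chain_ne, ?_⟩, ?_⟩
  · rintro ⟨i, x⟩ hx ⟨h, hh⟩
    have h1 : x ≠ 1 := w.ne_one _ hx
    have h2 := w.normalized i x hx
    -- A transversal letter in the base image would factor in two ways, as `x * 1` and as `1 * x`.
    have := (d.compl i).1 (a₁ := (⟨φ i h, h, rfl⟩, ⟨1, d.one_mem i⟩))
      (a₂ := (⟨1, one_mem _⟩, ⟨x, h2⟩)) (by simpa using hh)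
    exact h1 (by simpa using (congrArg (fun p => (p.2 : G i)) this).symm)
  · rw [← hw, NormalWord.prod, CoprodI.Word.prod, listProd, map_list_prod, List.map_map]
    simp [Function.comp_def]

/-- Passing to normal form for a fixed transversal keeps the sequence of factors, and normal forms
are unique. This makes length well defined. -/
theorem map_fst_eq_of_base_mul_listProd_eq (hφ : ∀ i, Injective (φ i)) {c c' : H}
    {l l' : List (Σ i, G i)} (hl : IsReducedList φ l) (hl' : IsReducedList φ l')
    (h : base φ c * listProd φ l = base φ c' * listProd φ l') :
    l.map Sigma.fst = l'.map Sigma.fst := by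
  classical
  obtain ⟨d⟩ := NormalWord.transversal_nonempty φ hφ
  have key : ∀ (c : H) (l : List (Σ i, G i)), IsReducedList φ l →
      ∃ w : NormalWord d, w.prod = base φ c * listProd φ l ∧
        w.toList.map Sigma.fst = l.map Sigma.fst := by
    intro c l hl
    let u : CoprodI.Word G := ⟨l, fun x hx h => hl.2 x hx (h ▸ one_mem _), hl.1⟩
    have hu : Reduced φ u := hl.2
    obtain ⟨w, hw, hmap⟩ := hu.exists_normalWord_prod_eq d
    refine ⟨c • w, ?_, hmap⟩
    rw [NormalWord.prod_base_smul, hw, CoprodI.Word.prod, listProd, map_list_prod, List.map_map]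
    simp [Function.comp_def, u]
  obtain ⟨w, hw, hmap⟩ := key c l hl
  obtain ⟨w', hw', hmap'⟩ := key c' l' hl'
  rw [← hmap, ← hmap', NormalWord.prod_injective ((hw.trans h).trans hw'.symm)]

variable (φ) in
/-- The element `g` is a product of base elements and a reduced list of length `n`. -/
def HasLength (g : PushoutI φ) (n : ℕ) : Prop :=
  ∃ (c : H) (l : List (Σ i, G i)), IsReducedList φ l ∧ l.length = n ∧ g = base φ c * listProd φ l

theorem exists_hasLength (hφ : ∀ i, Injective (φ i)) (g : PushoutI φ) : ∃ n, HasLength φ g n := by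
  obtain ⟨c, l, hl, h⟩ := exists_base_mul_listProd_eq hφ g
  exact ⟨_, c, l, hl, rfl, h⟩

theorem HasLength.unique (hφ : ∀ i, Injective (φ i)) {g : PushoutI φ} {m n : ℕ}
    (hm : HasLength φ g m) (hn : HasLength φ g n) : m = n := by
  obtain ⟨c, l, hl, rfl, h⟩ := hm
  obtain ⟨c', l', hl', rfl, h'⟩ := hn
  simpa using congrArg List.length (map_fst_eq_of_base_mul_listProd_eq hφ hl hl' (h.symm.trans h'))

theorem IsReducedList.hasLength {l : List (Σ i, G i)} (hl : IsReducedList φ l) :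
    HasLength φ (listProd φ l) l.length :=
  ⟨1, l, hl, rfl, by simp⟩

theorem HasLength.base_mul {g : PushoutI φ} {n : ℕ} (h : HasLength φ g n) (c : H) :
    HasLength φ (base φ c * g) n := by
  obtain ⟨c', l, hl, hn, rfl⟩ := h
  exact ⟨c * c', l, hl, hn, by simp [mul_assoc]⟩

theorem HasLength.mul_base {g : PushoutI φ} {n : ℕ} (h : HasLength φ g n) (d : H) :
    HasLength φ (g * base φ d) n := by
  obtain ⟨c, l, hl, hn, rfl⟩ := h
  obtain ⟨c', l', hl', hmap, h'⟩ := exists_listProd_mul_base hl d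
  refine ⟨c * c', l', hl', ?_, by rw [mul_assoc, h', map_mul, mul_assoc]⟩
  rw [← hn]
  simpa using congrArg List.length hmap

/-- An element of positive length is the product of a reduced list. -/
theorem HasLength.exists_listProd_eq {g : PushoutI φ} {n : ℕ} (h : HasLength φ g n) (hn : n ≠ 0) :
    ∃ l, IsReducedList φ l ∧ l.length = n ∧ g = listProd φ l := by
  obtain ⟨c, l, hl, rfl, rfl⟩ := h
  rcases l with _ | ⟨x, l⟩
  · simp at hn
  have hmap : ((⟨x.1, φ x.1 c * x.2⟩ : Σ i, G i) :: l).map Sigma.fst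
      = (x :: l).map Sigma.fst := by simp
  refine ⟨⟨x.1, φ x.1 c * x.2⟩ :: l, hl.of_map_fst_eq hmap ?_, by simp, ?_⟩
  · intro y hy
    rcases List.mem_cons.1 hy with rfl | hy
    · have := hl.2 x List.mem_cons_self
      rwa [Subgroup.mul_mem_cancel_left _ (MonoidHom.mem_range.2 ⟨c, rfl⟩)]
    · exact hl.2 y (List.mem_cons_of_mem _ hy)
  · simp [of_apply_eq_base, mul_assoc]

theorem hasLength_base (c : H) : HasLength φ (base φ c) 0 :=
  ⟨c, [], ⟨by simp, by simp⟩, rfl, by simp⟩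

theorem isReducedList_singleton {i : ι} {x : G i} (hx : x ∉ (φ i).range) :
    IsReducedList φ [⟨i, x⟩] :=
  ⟨by simp, by simpa using hx⟩

theorem exists_hasLength_of (i : ι) (x : G i) : ∃ n ≤ 1, HasLength φ (of i x) n := by
  by_cases hx : x ∈ (φ i).range
  · obtain ⟨c, rfl⟩ := hx
    exact ⟨0, zero_le_one, by rw [of_apply_eq_base]; exact hasLength_base c⟩
  · exact ⟨1, le_rfl, by simpa using (isReducedList_singleton hx).hasLength⟩

theorem listInv_cons (x : Σ i, G i) (l : List (Σ i, G i)) :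
    listInv (x :: l) = listInv l ++ [⟨x.1, x.2⁻¹⟩] := by
  simp [listInv]

/-- Nothing merges at the junction, so the concatenated word is already reduced. -/
theorem hasLength_listProd_inv_mul_of_ne {x y : Σ i, G i} {l m : List (Σ i, G i)}
    (hl : IsReducedList φ (x :: l)) (hm : IsReducedList φ (y :: m)) (hxy : y.1 ≠ x.1) :
    HasLength φ ((listProd φ (y :: m))⁻¹ * listProd φ (x :: l)) (m.length + l.length + 2) := by
  have hmr := hm.listInv
  have hred : IsReducedList φ (listInv (y :: m) ++ x :: l) := by
    refine ⟨?_, ?_⟩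
    · rw [List.isChain_append]
      refine ⟨hmr.1, hl.1, ?_⟩
      rw [listInv_cons]
      simpa using hxy
    · intro z hz
      rcases List.mem_append.1 hz with hz | hz
      · exact hmr.2 z hz
      · exact hl.2 z hz
  have h := hred.hasLength
  rw [listProd_append, listProd_listInv] at h
  convert h using 1
  simp
  omega

/-- Two reduced lists whose quotient is short start with the same coset of the base group. -/
theorem exists_of_eq_of_mul_base (hφ : ∀ i, Injective (φ i)) {i : ι} {s s' : G i}
    {l m : List (Σ i, G i)} (hl : IsReducedList φ (⟨i, s⟩ :: l))
    (hm : IsReducedList φ (⟨i, s'⟩ :: m)) {n : ℕ}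
    (hn : HasLength φ ((listProd φ (⟨i, s'⟩ :: m))⁻¹ * listProd φ (⟨i, s⟩ :: l)) n)
    (hlt : n < m.length + l.length + 1) :
    ∃ c, (of i s : PushoutI φ) = of i s' * base φ c := by
  by_cases hs : s'⁻¹ * s ∈ (φ i).range
  · obtain ⟨c, hc⟩ := hs
    exact ⟨c, by rw [← of_apply_eq_base φ i, hc, ← map_mul, mul_inv_cancel_left]⟩
  exfalso
  -- The two first letters merge into one letter outside the base, so the length drops by only one.
  have hred : IsReducedList φ (listInv m ++ ⟨i, s'⁻¹ * s⟩ :: l) := by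
    refine ⟨List.isChain_split.2 ⟨?_, ?_⟩, ?_⟩
    · refine isChain_fst_ne_of_map_fst_eq hm.listInv.1 ?_
      simp [listInv_cons]
    · exact isChain_fst_ne_of_map_fst_eq hl.1 (by simp)
    · intro z hz
      rcases List.mem_append.1 hz with hz | hz
      · exact hm.tail.listInv.2 z hz
      · rcases List.mem_cons.1 hz with rfl | hz
        · exact hs
        · exact hl.tail.2 z hz
  have h1 := hred.hasLength
  have : listProd φ (listInv m ++ ⟨i, s'⁻¹ * s⟩ :: l) =
      (listProd φ (⟨i, s'⟩ :: m))⁻¹ * listProd φ (⟨i, s⟩ :: l) := by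
    simp [listProd_listInv, mul_assoc]
  rw [this] at h1
  have := h1.unique hφ hn
  simp at this
  omega

/-! ### Finite subgroups of amalgamated products -/

/-- A subgroup of an amalgamated product all of whose elements lie in factors lies in a factor. -/
theorem exists_le_range_of [Nonempty ι] (hφ : ∀ i, Injective (φ i)) (F : Subgroup (PushoutI φ))
    (hF : ∀ f ∈ F, ∃ n ≤ 1, HasLength φ f n) : ∃ i, F ≤ (of (φ := φ) i).range := by
  by_cases h0 : ∀ f ∈ F, HasLength φ f 0
  · inhabit ι
    refine ⟨default, fun f hf => ?_⟩
    obtain ⟨c, l, -, hl, rfl⟩ := h0 f hf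
    obtain rfl := List.length_eq_zero_iff.1 hl
    exact ⟨φ _ c, by simp [of_apply_eq_base]⟩
  push Not at h0
  obtain ⟨f, hf, hf0⟩ := h0
  have getl : ∀ g ∈ F, ¬ HasLength φ g 0 → ∃ x : Σ i, G i, IsReducedList φ [x] ∧
      g = listProd φ [x] := by
    intro g hg hg0
    obtain ⟨n, hn, h⟩ := hF g hg
    rcases Nat.le_one_iff_eq_zero_or_eq_one.1 hn with rfl | rfl
    · exact absurd h hg0
    · obtain ⟨l, hl, hl1, rfl⟩ := h.exists_listProd_eq one_ne_zero
      obtain ⟨x, rfl⟩ := List.length_eq_one_iff.1 hl1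
      exact ⟨x, hl, rfl⟩
  obtain ⟨x, hx, rfl⟩ := getl f hf hf0
  refine ⟨x.1, fun g hg => ?_⟩
  by_cases hg0 : HasLength φ g 0
  · obtain ⟨c, l, -, hl, rfl⟩ := hg0
    obtain rfl := List.length_eq_zero_iff.1 hl
    exact ⟨φ _ c, by simp [of_apply_eq_base]⟩
  obtain ⟨y, hy, rfl⟩ := getl g hg hg0
  by_cases hxy : x.1 = y.1
  · rw [hxy]
    exact ⟨y.2, by simp⟩
  exfalso
  have hred : IsReducedList φ [x, y] := by
    refine ⟨by simpa using hxy, ?_⟩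
    have := hx.2
    have := hy.2
    simp_all
  obtain ⟨n, hn, h⟩ := hF _ (mul_mem hf hg)
  have h2 := hred.hasLength
  have : listProd φ [x, y] = listProd φ [x] * listProd φ [y] := by simp
  rw [this] at h2
  have := h2.unique hφ h
  simp at this
  omega

/-- A subgroup of bounded length of an amalgamated product is conjugate into a factor. -/
theorem exists_conj_mem_range_of_bounded [Nonempty ι] (hφ : ∀ i, Injective (φ i)) (L : ℕ)
    (F : Subgroup (PushoutI φ)) (hF : ∀ f ∈ F, ∃ n ≤ L, HasLength φ f n) :
    ∃ i g, ∀ f ∈ F, g⁻¹ * f * g ∈ (of (φ := φ) i).range := by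
  induction L generalizing F with
  | zero =>
    obtain ⟨i, hi⟩ := exists_le_range_of hφ F fun f hf => by
      obtain ⟨n, hn, h⟩ := hF f hf
      exact ⟨n, by omega, h⟩
    exact ⟨i, 1, fun f hf => by simpa using hi hf⟩
  | succ L ih =>
    -- Bound 1 is a separate base case: conjugating a factor element by `s` may leave a letter, so
    -- the step needs `1 ≤ L`.
    rcases Nat.eq_zero_or_pos L with rfl | hL
    · obtain ⟨i, hi⟩ := exists_le_range_of hφ F hF
      exact ⟨i, 1, fun f hf => by simpa using hi hf⟩
    by_cases hmax : ∃ f ∈ F, HasLength φ f (L + 1)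
    swap
    · push Not at hmax
      refine ih F fun f hf => ?_
      obtain ⟨n, hn, h⟩ := hF f hf
      refine ⟨n, ?_, h⟩
      have : n ≠ L + 1 := fun e => hmax f hf (e ▸ h)
      omega
    obtain ⟨f₀, hf₀, h₀⟩ := hmax
    obtain ⟨l₀, hl₀, hlen₀, rfl⟩ := h₀.exists_listProd_eq (by omega)
    rcases l₀ with _ | ⟨⟨i, s⟩, t⟩
    · simp at hlen₀
    have ht : t.length = L := by simpa using hlen₀
    -- Otherwise the quotient with the longest element `s t` would exceed the bound `L + 1`.
    have hfst : ∀ y m, IsReducedList φ (y :: m) → listProd φ (y :: m) ∈ F → y.1 = i := by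
      intro y m hm hmF
      by_contra hyi
      obtain ⟨n, hn, h⟩ := hF _ (mul_mem (inv_mem hmF) hf₀)
      have := h.unique hφ (hasLength_listProd_inv_mul_of_ne hl₀ hm hyi)
      omega
    have hstart : ∀ (s' : G i) m, IsReducedList φ (⟨i, s'⟩ :: m) →
        listProd φ (⟨i, s'⟩ :: m) ∈ F → m ≠ [] →
        ∃ c, (of i s : PushoutI φ) = of i s' * base φ c := by
      intro s' m hm hmF hne
      obtain ⟨n, hn, h⟩ := hF _ (mul_mem (inv_mem hmF) hf₀)
      have := List.length_pos_iff.2 hne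
      exact exists_of_eq_of_mul_base hφ hl₀ hm h (by omega)
    have hconj : ∀ f ∈ F, ∃ n ≤ L, HasLength φ ((of i s)⁻¹ * f * of i s) n := by
      intro f hf
      have hfac : ∀ x : G i, ∃ n ≤ L, HasLength φ ((of i s)⁻¹ * of i x * of i s) n := by
        intro x
        obtain ⟨n, hn, h⟩ := exists_hasLength_of (φ := φ) i (s⁻¹ * x * s)
        exact ⟨n, by omega, by simpa using h⟩
      obtain ⟨n, hn, h⟩ := hF f hf
      rcases Nat.eq_zero_or_pos n with rfl | hpos
      · obtain ⟨c, l, -, hl, rfl⟩ := h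
        obtain rfl := List.length_eq_zero_iff.1 hl
        simpa [of_apply_eq_base] using hfac (φ i c)
      obtain ⟨l, hl, rfl, rfl⟩ := h.exists_listProd_eq (by omega)
      rcases l with _ | ⟨⟨j, s'⟩, m⟩
      · simp at hpos
      obtain rfl : j = i := hfst _ _ hl hf
      rcases List.eq_nil_or_concat m with rfl | ⟨m, ⟨k, z⟩, rfl⟩
      · simpa using hfac s'
      rw [List.concat_eq_append] at *
      have hinv : listInv (⟨j, s'⟩ :: (m ++ [⟨k, z⟩])) = ⟨k, z⁻¹⟩ :: listInv (⟨j, s'⟩ :: m) := by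
        simp [listInv]
      have hl' := hl.listInv
      have hf' := inv_mem hf
      rw [← listProd_listInv] at hf'
      rw [hinv] at hl' hf'
      obtain rfl : k = j := hfst _ _ hl' hf'
      -- Applied to `f` and to `f⁻¹`: conjugation by `s` absorbs both end letters of `f` into the
      -- base, leaving only `m`.
      obtain ⟨c, hc⟩ := hstart s' _ hl hf (by simp)
      obtain ⟨d, hd⟩ := hstart z⁻¹ _ hl' hf' (by simp [listInv])
      have hm : IsReducedList φ m :=
        ⟨(List.isChain_append.1 hl.tail.1).1, fun x hx => hl.tail.2 x (List.mem_append_left _ hx)⟩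
      refine ⟨m.length, by simp at hn; omega, ?_⟩
      have heq : (of k s : PushoutI φ)⁻¹ * listProd φ (⟨k, s'⟩ :: (m ++ [⟨k, z⟩])) * of k s =
          base φ c⁻¹ * listProd φ m * base φ d := by
        conv_lhs => rw [mul_assoc]; congr; · rw [hc]
                    · rw [hd]
        simp [mul_assoc]
      rw [heq]
      exact (hm.hasLength.base_mul _).mul_base _
    obtain ⟨j, g, hg⟩ := ih (F.map (MulAut.conj (of i s : PushoutI φ)⁻¹).toMonoidHom) (by
      rintro _ ⟨f, hf, rfl⟩
      simpa using hconj f hf)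
    refine ⟨j, of i s * g, fun f hf => ?_⟩
    have := hg _ ⟨f, hf, rfl⟩
    simpa [mul_assoc] using this

/-- A finite subgroup of an amalgamated product is conjugate into a factor. -/
theorem exists_conj_mem_range_of_finite [Nonempty ι] (hφ : ∀ i, Injective (φ i))
    (F : Subgroup (PushoutI φ)) [Finite F] :
    ∃ i g, ∀ f ∈ F, g⁻¹ * f * g ∈ (of (φ := φ) i).range := by
  choose len hlen using exists_hasLength hφ
  obtain ⟨L, hL⟩ := (Set.finite_range fun f : F => len f).bddAbove
  exact exists_conj_mem_range_of_bounded hφ L F fun f hf =>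
    ⟨len f, hL ⟨⟨f, hf⟩, rfl⟩, hlen f⟩

end ReducedList

end Monoid.PushoutI

/-- If `G` has a homomorphism `ψ` to an amalgamated product which the homomorphism `π` inverts on the
finite subgroup `F`, then `F` is conjugate into the image of a factor. -/
theorem Monoid.PushoutI.exists_conj_mem_range_comp_of {ι : Type*} [Nonempty ι] {K : ι → Type*}
    {K₀ : Type*} [∀ i, Group (K i)] [Group K₀] {φ : ∀ i, K₀ →* K i} (hφ : ∀ i, Injective (φ i))
    {G : Type*} [Group G] (ψ : G →* PushoutI φ) (π : PushoutI φ →* G) (F : Subgroup G) [Finite F]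
    (hF : ∀ f ∈ F, π (ψ f) = f) :
    ∃ i g, ∀ f ∈ F, g⁻¹ * f * g ∈ (π.comp (PushoutI.of i)).range := by
  have : Finite (F.map ψ) := Set.Finite.to_subtype ((Set.toFinite (F : Set G)).image ψ)
  obtain ⟨i, g, hg⟩ := PushoutI.exists_conj_mem_range_of_finite hφ (F.map ψ)
  refine ⟨i, π g, fun f hf => ?_⟩
  obtain ⟨k, hk⟩ := hg (ψ f) ⟨f, hf, rfl⟩
  exact ⟨k, by rw [MonoidHom.comp_apply, hk, map_mul, map_mul, map_inv, hF f hf]⟩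

/-- The canonical homomorphism from an amalgamated product of subgroups of a group. -/
theorem Monoid.PushoutI.exists_hom_of_le {ι : Type*} {G : Type*} [Group G] {K : ι → Subgroup G}
    {K₀ : Subgroup G} (hK : ∀ i, K₀ ≤ K i) :
    ∃ π : PushoutI (fun i => Subgroup.inclusion (hK i)) →* G,
      ∀ i (x : K i), π (PushoutI.of i x) = x := by
  refine ⟨PushoutI.lift (fun i => (K i).subtype) K₀.subtype
    fun i => Subgroup.subtype_comp_inclusion (hK i), fun i x => ?_⟩
  rw [PushoutI.lift_of]
  rfl

/-! ### Vertex subgroups of internal graph products -/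

section VertexSubgroup

variable {V : Type*} {G : Type*} [Group G] {Γ : SimpleGraph V} {H : V → Subgroup G}

theorem le_vertexSubgroup {A : Set V} {a : V} (ha : a ∈ A) : H a ≤ vertexSubgroup H A :=
  fun _ hx => Subgroup.subset_closure (Set.mem_biUnion ha hx)

theorem vertexSubgroup_le {A : Set V} {K : Subgroup G} :
    vertexSubgroup H A ≤ K ↔ ∀ a ∈ A, H a ≤ K := by
  simp [vertexSubgroup, Subgroup.closure_le]

theorem vertexSubgroup_mono {A B : Set V} (h : A ⊆ B) : vertexSubgroup H A ≤ vertexSubgroup H B :=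
  vertexSubgroup_le.2 fun _ ha => le_vertexSubgroup (h ha)

theorem vertexSubgroup_eq_iSup (A : Set V) : vertexSubgroup H A = ⨆ a : A, H a :=
  le_antisymm (vertexSubgroup_le.2 fun a ha => le_iSup (fun a : A => H a) ⟨a, ha⟩)
    (iSup_le fun a => le_vertexSubgroup a.2)

namespace IsInternalGraphProduct

/-- The universal property of an internal graph product. -/
theorem exists_hom (hG : IsInternalGraphProduct Γ H) {P : Type*} [Group P] (f : ∀ a, H a →* P)
    (hf : ∀ a b, Γ.Adj a b → ∀ x y, Commute (f a x) (f b y)) :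
    ∃ ψ : G →* P, ∀ a (x : H a), ψ x = f a x := by
  obtain ⟨e, he⟩ := hG
  have hker : Subgroup.normalClosure (graphProductRels Γ fun a => H a) ≤
      (CoprodI.lift f).ker := by
    refine Subgroup.normalClosure_le_normal ?_
    rintro _ ⟨a, b, g, h, hab, rfl⟩
    have := hf a b hab g h
    simp [MonoidHom.mem_ker, mul_assoc, this.eq]
  let ψ : GraphProduct Γ (fun a => H a) →* P := QuotientGroup.lift _ (CoprodI.lift f) hker
  refine ⟨ψ.comp e.symm.toMonoidHom, fun a x => ?_⟩
  have : e.symm (x : G) = GraphProduct.of Γ (fun a => H a) a x := by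
    rw [← he, e.symm_apply_apply]
  change ψ (e.symm x) = _
  rw [this]
  change QuotientGroup.lift _ (CoprodI.lift f) hker (QuotientGroup.mk' _ (CoprodI.of x)) = _
  simp

theorem commute (hG : IsInternalGraphProduct Γ H) {a b : V} (hab : Γ.Adj a b) {x y : G}
    (hx : x ∈ H a) (hy : y ∈ H b) : Commute x y := by
  obtain ⟨e, he⟩ := hG
  have h : Commute (GraphProduct.of Γ (fun a => H a) a ⟨x, hx⟩)
      (GraphProduct.of Γ (fun a => H a) b ⟨y, hy⟩) := by
    have hr := Subgroup.subset_normalClosure (s := graphProductRels Γ fun a => H a)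
      ⟨a, b, ⟨x, hx⟩, ⟨y, hy⟩, hab, rfl⟩
    have hr' := (QuotientGroup.eq_one_iff _).2 hr
    change (GraphProduct.of Γ (fun a => H a) a ⟨x, hx⟩)⁻¹ *
      (GraphProduct.of Γ (fun a => H a) b ⟨y, hy⟩)⁻¹ *
      (GraphProduct.of Γ (fun a => H a) a ⟨x, hx⟩) *
      (GraphProduct.of Γ (fun a => H a) b ⟨y, hy⟩) = 1 at hr'
    rw [mul_assoc, ← mul_inv_rev, inv_mul_eq_one] at hr'
    exact hr'.symm
  have := h.map e
  rwa [he, he] at this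

theorem vertexSubgroup_univ (hG : IsInternalGraphProduct Γ H) :
    vertexSubgroup H Set.univ = ⊤ := by
  obtain ⟨e, he⟩ := hG
  rw [eq_top_iff]
  intro g _
  obtain ⟨q, rfl⟩ := e.surjective g
  obtain ⟨w, rfl⟩ := QuotientGroup.mk'_surjective _ q
  induction w using CoprodI.induction_on with
  | one => rw [map_one]; exact (map_one e).symm ▸ one_mem _
  | of a x =>
    have := he a x
    change e (GraphProduct.of Γ (fun a => H a) a x) ∈ _
    rw [this]
    exact le_vertexSubgroup (Set.mem_univ a) x.2
  | mul x y hx hy =>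
    rw [map_mul]
    exact (map_mul e _ _).symm ▸ mul_mem (hx trivial) (hy trivial)

theorem finite_vertexSubgroup [Finite V] (hG : IsInternalGraphProduct Γ H)
    (hfin : ∀ a, Finite (H a)) {C : Set V} (hC : Γ.IsClique C) : Finite (vertexSubgroup H C) := by
  have := Fintype.ofFinite C
  have hcomm : Pairwise fun a b : C => ∀ x y : G, x ∈ H a → y ∈ H b → Commute x y :=
    fun a b hab x y hx hy => hG.commute (hC a.2 b.2 fun h => hab (Subtype.ext h)) hx hy
  rw [vertexSubgroup_eq_iSup, ← Subgroup.noncommPiCoprod_range (hcomm := hcomm)]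
  exact Set.finite_range _

/-- If a conjugate of `G(C)` lies in `G(D)` then `C ⊆ D`. -/
theorem subset_of_map_conj_le (hG : IsInternalGraphProduct Γ H) (hne : ∀ a, H a ≠ ⊥)
    {C D : Set V} {g : G}
    (h : (vertexSubgroup H C).map (MulAut.conj g).toMonoidHom ≤ vertexSubgroup H D) : C ⊆ D := by
  classical
  intro v hv
  by_contra hvD
  -- This map fixes the group at `v` and kills all others. Its kernel contains `G(D)`, and being
  -- normal it would contain the group at `v`.
  obtain ⟨ψ, hψ⟩ := hG.exists_hom (fun a => if a = v then (H a).subtype else 1) (by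
    intro a b hab x y
    by_cases ha : a = v
    · have hb : b ≠ v := fun hb => hab.ne (ha.trans hb.symm)
      simp [hb]
    · simp [ha])
  have hker : vertexSubgroup H D ≤ ψ.ker := vertexSubgroup_le.2 fun a ha x hx => by
    have hav : a ≠ v := fun h => hvD (h ▸ ha)
    simpa [hav] using hψ a ⟨x, hx⟩
  refine hne v ((Subgroup.eq_bot_iff_forall _).2 fun x hx => ?_)
  have h1 := hker (h ⟨x, le_vertexSubgroup hv hx, rfl⟩)
  have h2 := hψ v ⟨x, hx⟩
  simp only [if_true, Subgroup.coe_subtype] at h2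
  rw [MonoidHom.mem_ker] at h1
  simpa [h2] using h1

/-- Let `A i` be sets of vertices with common pairwise intersection `B` such that each edge of their
union lies in some `A i`. Then the inclusions of the vertex groups extend to a homomorphism to the
amalgamated product of the groups `G(A i)` over `G(B)`. -/
theorem exists_hom_pushoutI (hG : IsInternalGraphProduct Γ H) {ι : Type*} {A : ι → Set V}
    {B : Set V} (hB : ∀ i, B ⊆ A i) (hA : ∀ i j, i ≠ j → A i ∩ A j ⊆ B)
    (hadj : ∀ a b, Γ.Adj a b → a ∈ ⋃ i, A i → b ∈ ⋃ i, A i → ∃ i, a ∈ A i ∧ b ∈ A i) :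
    ∃ ψ : G →* PushoutI fun i => Subgroup.inclusion (vertexSubgroup_mono (H := H) (hB i)),
      ∀ i a (ha : a ∈ A i) (x : H a), ψ x = PushoutI.of i ⟨x, le_vertexSubgroup ha x.2⟩ := by
  have hex : ∀ a, ∃ f : H a →*
      PushoutI (fun i => Subgroup.inclusion (vertexSubgroup_mono (H := H) (hB i))),
      (∀ i (ha : a ∈ A i) x, f x = PushoutI.of i ⟨x, le_vertexSubgroup ha x.2⟩) ∧
        (a ∉ ⋃ i, A i → f = 1) := by
    intro a
    by_cases ha : a ∈ ⋃ i, A i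
    swap
    · exact ⟨1, fun i h => absurd (Set.mem_iUnion.2 ⟨i, h⟩) ha, fun _ => rfl⟩
    obtain ⟨j, hj⟩ := Set.mem_iUnion.1 ha
    refine ⟨(PushoutI.of j).comp (Subgroup.inclusion (le_vertexSubgroup hj)), fun i hi x => ?_,
      fun h => absurd ha h⟩
    by_cases hij : i = j
    · subst hij
      rfl
    -- A vertex in two of the sets lies in `B`, so both images agree with the one through the base.
    · have hx : (x : G) ∈ vertexSubgroup H B := 
        le_vertexSubgroup (hA i j hij ⟨hi, hj⟩) x.2
      let y : vertexSubgroup H B := ⟨x, hx⟩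
      exact (PushoutI.of_apply_eq_base _ j y).trans (PushoutI.of_apply_eq_base _ i y).symm
  choose f hf hf1 using hex
  obtain ⟨ψ, hψ⟩ := hG.exists_hom f (by
    intro a b hab x y
    by_cases ha : a ∈ ⋃ i, A i
    swap
    · simp [hf1 a ha]
    by_cases hb : b ∈ ⋃ i, A i
    swap
    · simp [hf1 b hb]
    obtain ⟨i, hai, hbi⟩ := hadj a b hab ha hb
    rw [hf a i hai, hf b i hbi]
    refine Commute.map ?_ (PushoutI.of i)
    exact Subtype.ext (hG.commute hab x.2 y.2 : (x : G) * y = y * x))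
  exact ⟨ψ, fun i a ha x => by rw [hψ, hf a i ha]⟩

/-- If `v` and `w` are not adjacent, then a finite subgroup of `G(A)` is conjugate into `G(A \ {v})`
or `G(A \ {w})`, since `G(A)` is the amalgamated product of these over `G(A \ {v, w})`. -/
theorem exists_conj_mem_vertexSubgroup_diff (hG : IsInternalGraphProduct Γ H) {A : Set V} {v w : V}
    (hvw : v ≠ w) (hadj : ¬ Γ.Adj v w) (F : Subgroup G) [Finite F]
    (hF : F ≤ vertexSubgroup H A) :
    ∃ (i : Bool) (g : G), ∀ f ∈ F, g⁻¹ * f * g ∈ vertexSubgroup H (A \ {cond i v w}) := by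
  have hB : ∀ i : Bool, A \ {v, w} ⊆ A \ {cond i v w} := by
    rintro (_ | _) a ⟨ha, h⟩
    · exact ⟨ha, fun h' => h (Or.inr h')⟩
    · exact ⟨ha, fun h' => h (Or.inl h')⟩
  obtain ⟨ψ, hψ⟩ := hG.exists_hom_pushoutI hB (by
    rintro (_ | _) (_ | _) hij a ⟨⟨ha, h⟩, -, h'⟩
    · exact absurd rfl hij
    · exact ⟨ha, fun h'' => h''.elim h' h⟩
    · exact ⟨ha, fun h'' => h''.elim h h'⟩
    · exact absurd rfl hij) (by
    intro a b hab ha hb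
    have ha : a ∈ A := (Set.mem_iUnion.1 ha).choose_spec.1
    have hb : b ∈ A := (Set.mem_iUnion.1 hb).choose_spec.1
    by_contra! h
    have h1 : a ≠ v → b = v := fun h' => by
      by_contra hbv
      exact h true ⟨ha, h'⟩ ⟨hb, hbv⟩
    have h2 : a ≠ w → b = w := fun h' => by
      by_contra hbw
      exact h false ⟨ha, h'⟩ ⟨hb, hbw⟩
    by_cases hav : a = v
    · have hbw := h2 fun haw => hvw (hav.symm.trans haw)
      exact hadj (hav ▸ hbw ▸ hab)
    · have hbv := h1 hav
      by_cases haw : a = w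
      · exact hadj (haw ▸ hbv ▸ hab.symm)
      · exact hvw (hbv.symm.trans (h2 haw)))
  obtain ⟨π, hπ⟩ := PushoutI.exists_hom_of_le fun i => vertexSubgroup_mono (H := H) (hB i)
  -- Only this half of the amalgam decomposition of `G(A)` is needed.
  have hle : vertexSubgroup H A ≤ (π.comp ψ).eqLocus (MonoidHom.id G) := by
    refine vertexSubgroup_le.2 fun a ha x hx => ?_
    obtain ⟨i, hai⟩ : ∃ i, a ∈ A \ {cond i v w} := by
      by_cases hav : a = v
      · exact ⟨false, ha, fun h => hvw (hav.symm.trans h)⟩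
      · exact ⟨true, ha, hav⟩
    exact (congrArg π (hψ i a hai ⟨x, hx⟩)).trans (hπ i _)
  obtain ⟨i, g, h⟩ := PushoutI.exists_conj_mem_range_comp_of
    (fun i => Subgroup.inclusion_injective (vertexSubgroup_mono (hB i))) ψ π F
    fun x hx => hle (hF hx)
  refine ⟨i, g, fun x hx => ?_⟩
  obtain ⟨k, hk⟩ := h x hx
  rw [← hk, MonoidHom.comp_apply, hπ]
  exact k.2

/-- A finite subgroup of an internal graph product is conjugate into `G(C)` for a complete set `C`
of vertices. -/
theorem exists_isClique_conj_mem [Finite V] (hG : IsInternalGraphProduct Γ H) (F : Subgroup G)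
    [Finite F] :
    ∃ (C : Set V) (g : G), Γ.IsClique C ∧ ∀ f ∈ F, g⁻¹ * f * g ∈ vertexSubgroup H C := by
  -- A minimal such `A` is complete, since a nonadjacent pair would allow a vertex to be removed.
  obtain ⟨A, ⟨g, hg⟩, hmin⟩ := Set.Finite.exists_minimal
    (s := {A : Set V | ∃ g : G, ∀ f ∈ F, g⁻¹ * f * g ∈ vertexSubgroup H A}) (Set.toFinite _)
    ⟨Set.univ, 1, fun f _ => hG.vertexSubgroup_univ ▸ Subgroup.mem_top _⟩
  refine ⟨A, g, fun v hv w hw hvw => ?_, hg⟩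
  by_contra hadj
  have hmap : F.map (MulAut.conj g⁻¹).toMonoidHom ≤ vertexSubgroup H A := by
    rintro _ ⟨f, hf, rfl⟩
    simpa using hg f hf
  have : Finite (F.map (MulAut.conj g⁻¹).toMonoidHom) :=
    Set.Finite.to_subtype ((Set.toFinite (F : Set G)).image _)
  obtain ⟨i, k, hk⟩ := hG.exists_conj_mem_vertexSubgroup_diff hvw hadj _ hmap
  have hmem : cond i v w ∈ A := by cases i <;> assumption
  refine (hmin (y := A \ {cond i v w}) ⟨g * k, fun f hf => ?_⟩ Set.sdiff_subset hmem).2 rfl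
  simpa [mul_assoc] using hk _ ⟨f, hf, rfl⟩

/-- A finite subgroup of an internal graph product is conjugate into `G(C)` for a maximal complete
set `C` of vertices. -/
theorem exists_isMaximalClique_map_conj_le [Finite V] (hG : IsInternalGraphProduct Γ H)
    (F : Subgroup G) [Finite F] :
    ∃ (C : Set V) (g : G), IsMaximalClique Γ C ∧
      F.map (MulAut.conj g).toMonoidHom ≤ vertexSubgroup H C := by
  obtain ⟨C, g, hC, hg⟩ := hG.exists_isClique_conj_mem F
  obtain ⟨D, hCD, hD⟩ := Finite.exists_le_maximal hC
  refine ⟨D, g⁻¹, hD, ?_⟩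
  rintro _ ⟨f, hf, rfl⟩
  simpa using vertexSubgroup_mono hCD (hg f hf)

end IsInternalGraphProduct

end VertexSubgroup

/-! ### Conjugacy classes and the main theorem -/

section Conjugacy

variable {G : Type*} [Group G]

theorem map_conj_map_conj (F : Subgroup G) (g h : G) :
    (F.map (MulAut.conj g).toMonoidHom).map (MulAut.conj h).toMonoidHom =
      F.map (MulAut.conj (h * g)).toMonoidHom := by
  rw [Subgroup.map_map]
  congr 1
  ext x
  simp [mul_assoc]

theorem subgroupConjClass_eq_iff {F K : Subgroup G} :
    subgroupConjClass F = subgroupConjClass K ↔ ∃ g, F.map (MulAut.conj g).toMonoidHom = K := by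
  refine ⟨fun h => ?_, ?_⟩
  · have : K ∈ subgroupConjClass K := ⟨1, by ext; simp⟩
    rw [← h] at this
    obtain ⟨g, hg⟩ := this
    exact ⟨g, hg.symm⟩
  · rintro ⟨g, rfl⟩
    ext L
    constructor
    · rintro ⟨k, rfl⟩
      exact ⟨k * g⁻¹, by rw [map_conj_map_conj, inv_mul_cancel_right]⟩
    · rintro ⟨k, rfl⟩
      exact ⟨k * g, by rw [map_conj_map_conj]⟩

end Conjugacy

theorem mainTheorem4 {V : Type*} {V' : Type*} {G : Type*} [Finite V] [Finite V'] [Group G]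
    (Γ : SimpleGraph V) (Γ' : SimpleGraph V')
    (H : V → Subgroup G) (H' : V' → Subgroup G)
    (hfin : ∀ a, Finite (H a)) (hfin' : ∀ a, Finite (H' a))
    (hne : ∀ a, H a ≠ ⊥) (hne' : ∀ a, H' a ≠ ⊥)
    (hG : IsInternalGraphProduct Γ H) (hG' : IsInternalGraphProduct Γ' H') :
    ∀ C : Set V, IsMaximalClique Γ C →
      ∃! C' : Set V', IsMaximalClique Γ' C' ∧
        subgroupConjClass (vertexSubgroup H C) = subgroupConjClass (vertexSubgroup H' C') := by
  intro C hC
  have := hG.finite_vertexSubgroup hfin hC.prop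
  obtain ⟨C', g, hC', hg⟩ := hG'.exists_isMaximalClique_map_conj_le (vertexSubgroup H C)
  have := hG'.finite_vertexSubgroup hfin' hC'.prop
  obtain ⟨D, k, hD, hk⟩ := hG.exists_isMaximalClique_map_conj_le (vertexSubgroup H' C')
  have hkg : (vertexSubgroup H C).map (MulAut.conj (k * g)).toMonoidHom ≤ vertexSubgroup H D := by
    rw [← map_conj_map_conj]
    exact (Subgroup.map_mono hg).trans hk
  obtain rfl : C = D := hC.eq_of_subset hD.prop (hG.subset_of_map_conj_le hne hkg)
  have hcard : ∀ (F : Subgroup G) (x : G),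
      Nat.card (F.map (MulAut.conj x).toMonoidHom) = Nat.card F := fun F x =>
    Subgroup.card_map_of_injective (MulAut.conj x).injective
  have heq : (vertexSubgroup H C).map (MulAut.conj g).toMonoidHom = vertexSubgroup H' C' := by
    refine Subgroup.eq_of_le_of_card_ge hg ?_
    -- The conjugate of `G(C')` by `k` lies in `G(D) = G(C)`, which bounds its order.
    rw [hcard, ← hcard (vertexSubgroup H' C') k]
    exact Subgroup.card_le_of_le hk
  refine ⟨C', ⟨hC', subgroupConjClass_eq_iff.2 ⟨g, heq⟩⟩, ?_⟩
  rintro D' ⟨hD', hconj⟩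
  rw [subgroupConjClass_eq_iff.2 ⟨g, heq⟩] at hconj
  obtain ⟨x, hx⟩ := subgroupConjClass_eq_iff.1 hconj
  exact (hC'.eq_of_subset hD'.prop (hG'.subset_of_map_conj_le hne' hx.le)).symm
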